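/- Consider rings of $n\ge 2$ qubits with sites $j\in\mathbb Z/n\mathbb Z$. For an operator $b$ on two qubits let $b_j$ denote $b$ acting on the sites $j,j+1$ and as the identity elsewhere. A 2-site Lindblad Liouvillian is given by a Hermitian 2-site operator $H$ and finitely many traceless 2-site operators $L^{(1)},\dots,L^{(m)}$; it has nonzero dissipative part if the map $\rho\mapsto\sum_k\big([L^{(k)}\rho,L^{(k)\dagger}]+[L^{(k)},\rho L^{(k)\dagger}]\big)$ on 2-site operators is not zero. On the ring it gives the translationally invariant Liouvillian $\mathcal L=\sum_j\mathcal L_j$ with $$\mathcal L_j(\rho)=\mathrm i[\rho,H_j]+\sum_k\Big([L^{(k)}_j\rho,L^{(k)\dagger}_j]+[L^{(k)}_j,\rho L^{(k)\dagger}_j]\Big).$$ It globally conserves a 2-site operator $a$ on the ring of $n$ sites if $\sum_j\mathcal L_j\big(\sum_k a_k\big)=0$. **Theorem.** Let $\mu,\nu\in[0,1]$, let $h_x,h_y,h_z\in\mathbb R$, and let $$a=\sigma^x\otimes\sigma^x+\mu\,\sigma^y\otimes\sigma^y+\nu\,\sigma^z\otimes\sigma^z+w\otimes 1+1\otimes w,\qquad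 w=h_x\sigma^x+h_y\sigma^y+h_z\sigma^z .$$ 1. There is a 2-site Lindblad Liouvillian $(H,L^{(1)},\dots,L^{(m)})$ with nonzero dissipative part that globally conserves $a$ on the rings of every length $n\ge 2$ if and only if $\mu=\nu=h_y=h_z=0$. 2. For each single length $n\ge 5$, there is a 2-site Lindblad Liouvillian with nonzero dissipative part that globally conserves $a$ on the ring of $n$ sites if and only if $\mu=\nu=h_y=h_z=0$. -/

import Mathlib

open scoped Matrix Kronecker

noncomputable section

/-- Pauli matrices. -/
def σx : Matrix (Fin 2) (Fin 2) ℂ := !![0, 1; 1, 0]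

def σy : Matrix (Fin 2) (Fin 2) ℂ := !![0, -Complex.I; Complex.I, 0]

def σz : Matrix (Fin 2) (Fin 2) ℂ := !![1, 0; 0, -1]

/-- Operators on two qubits; `A ⊗ₖ B` acts by `A` on the first and by `B` on the second one. -/
abbrev TwoSiteOp : Type := Matrix (Fin 2 × Fin 2) (Fin 2 × Fin 2) ℂ

/-- Operators on a ring of `n` qubits with sites `ZMod n`, in the computational basis. -/
abbrev RingOp (n : ℕ) : Type := Matrix (ZMod n → Fin 2) (ZMod n → Fin 2) ℂ

/-- The operator `b_j` on the ring (with at least two sites) that acts as `b` on the sites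
`j, j + 1` and as the identity on all other sites. -/
def place {n : ℕ} (j : ZMod n) (b : TwoSiteOp) : RingOp n :=
  open Classical in
  fun s t => if ∀ i, i ≠ j → i ≠ j + 1 → s i = t i
    then b (s j, s (j + 1)) (t j, t (j + 1)) else 0

/-- The dissipator in diagonal form, `∑ k, ([L_k ρ, L_k†] + [L_k, ρ L_k†])`. -/
def dissipator {ι : Type*} [Fintype ι] {m : ℕ}
    (L : Fin m → Matrix ι ι ℂ) (ρ : Matrix ι ι ℂ) : Matrix ι ι ℂ :=
  ∑ k, (⁅L k * ρ, (L k)ᴴ⁆ + ⁅L k, ρ * (L k)ᴴ⁆)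

/-- The Lindblad generator with Hamiltonian `H` and Lindblad operators `L_k`. -/
def lindblad {ι : Type*} [Fintype ι] {m : ℕ} (H : Matrix ι ι ℂ)
    (L : Fin m → Matrix ι ι ℂ) (ρ : Matrix ι ι ℂ) : Matrix ι ι ℂ :=
  Complex.I • ⁅ρ, H⁆ + dissipator L ρ

/-- The data of a 2-site Lindblad Liouvillian: a Hermitian 2-site Hamiltonian and finitely many
2-site Lindblad operators, which are traceless (combinations of the 15 nontrivial Pauli
products), so that the splitting into Hamiltonian and dissipative part is unambiguous. -/
structure TwoSiteLiouvillian where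
  H : TwoSiteOp
  isHermitian_H : H.IsHermitian
  m : ℕ
  L : Fin m → TwoSiteOp
  trace_L : ∀ k, (L k).trace = 0

/-- The term `𝓛_j` of the translationally invariant Liouvillian, acting on operators on the
ring of `n` sites: the same Lindblad generator placed on the sites `j, j + 1`. -/
def TwoSiteLiouvillian.term (𝓛 : TwoSiteLiouvillian) {n : ℕ} [NeZero n] (j : ZMod n)
    (ρ : RingOp n) : RingOp n :=
  lindblad (place j 𝓛.H) (fun k => place j (𝓛.L k)) ρ

/-- Global conservation of `∑ k, a_k` on the ring of `n` sites: `∑ j, 𝓛_j (∑ k, a_k) = 0`. -/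
def TwoSiteLiouvillian.GloballyConserves (𝓛 : TwoSiteLiouvillian) (n : ℕ) [NeZero n]
    (a : TwoSiteOp) : Prop :=
  ∑ j : ZMod n, 𝓛.term j (∑ k : ZMod n, place k a) = 0

/-- The canonical 2-site interaction
`σx σx + μ σy σy + ν σz σz + w ⊗ 1 + 1 ⊗ w`, with `w = hx σx + hy σy + hz σz`. -/
def canonicalInteraction (μ ν hx hy hz : ℝ) : TwoSiteOp :=
  let w : Matrix (Fin 2) (Fin 2) ℂ := (hx : ℂ) • σx + (hy : ℂ) • σy + (hz : ℂ) • σz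
  σx ⊗ₖ σx + (μ : ℂ) • (σy ⊗ₖ σy) + (ν : ℂ) • (σz ⊗ₖ σz)
    + w ⊗ₖ (1 : Matrix (Fin 2) (Fin 2) ℂ) + (1 : Matrix (Fin 2) (Fin 2) ℂ) ⊗ₖ w

end

/-!
If `μ = ν = h_y = h_z = 0`, the interaction is a polynomial in the operators `σx` of the single
sites, so dephasing along `σx` annihilates it on every ring.

Conversely, write `A = ∑ k, a_k` and `q = 𝓛 1` for the image of the identity under the two-site
dissipator. A term `𝓛_j` acts on an `a_k` with disjoint support as multiplication by `q_j`. On a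
ring of at least five sites, these products carry components which no other term of the conservation
law has: taking the trace against a product of traceless operators on four consecutive sites, or
on an edge and a site adjacent to neither of its ends, shows that `q = u ⊗ 1 - 1 ⊗ u`
(`trace_kronecker_mul_eq_zero`, `trace_one_kronecker_add_eq_zero`), and hence `∑ j, q_j = 0`.

The Liouvillian on the ring is therefore unital, and the pairing of the conservation law with `A`
itself becomes `∑ j k, ‖[L_k at j, A]‖² = 0` (`trace_mul_dissipator`): the Hamiltonian part drops
out since `tr (A [A, H]) = 0`. So every placed Lindblad operator commutes with `A`
(`lie_place_eq_zero`). Comparing components at the two sites next to its support, a Lindblad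
operator `L` commutes with `σx ⊗ 1` and `1 ⊗ σx`, with the same operators for `σy` if `μ ≠ 0` and
for `σz` if `ν ≠ 0`, and with the interaction including the field of the neighbouring edges
(`lie_components_eq_zero`). A traceless `L ≠ 0` of this kind exists only if
`μ = ν = h_y = h_z = 0`.

No matrix elements on the ring are needed beyond the basic rules for placed operators: supports are
expressed through commutants (`TrivialAt`), and components are read off with the trace, which
factorises over sites (`trace_site_mul`).
-/

/-! ### One-site operators -/

section Site

variable {ι : Type*} [Fintype ι] [DecidableEq ι]

/-- The operator on the qubits indexed by `ι` that acts as `A` on qubit `i` and as the identity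
on all others. -/
def site (i : ι) (A : Matrix (Fin 2) (Fin 2) ℂ) : Matrix (ι → Fin 2) (ι → Fin 2) ℂ :=
  fun s t => if ∀ l, l ≠ i → s l = t l then A (s i) (t i) else 0

theorem site_one (i : ι) : site i 1 = 1 := by
  ext s t
  by_cases h : s = t
  · subst h; simp [site]
  · rw [Matrix.one_apply_ne h]
    unfold site
    split_ifs with h1
    · have : s i ≠ t i := fun h2 => h (by
        ext l; by_cases hl : l = i
        · subst hl; rw [h2]
        · rw [h1 l hl])
      exact Matrix.one_apply_ne this
    · rfl

theorem site_add (i : ι) (A B : Matrix (Fin 2) (Fin 2) ℂ) :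
    site i (A + B) = site i A + site i B := by
  ext s t
  simp only [site, Matrix.add_apply]
  split_ifs <;> simp

theorem site_smul (i : ι) (c : ℂ) (A : Matrix (Fin 2) (Fin 2) ℂ) :
    site i (c • A) = c • site i A := by
  ext s t
  simp [site, Matrix.smul_apply]

theorem site_mul (i : ι) (A B : Matrix (Fin 2) (Fin 2) ℂ) :
    site i (A * B) = site i A * site i B := by
  ext s t
  rw [Matrix.mul_apply,
    ← Fintype.sum_of_injective (Function.update s i) (Function.update_injective s i)
      (fun x => site i A s (Function.update s i x) * site i B (Function.update s i x) t)]
  · by_cases h : ∀ l, l ≠ i → s l = t l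
    · have h1 : ∀ x, ∀ l, l ≠ i → s l = Function.update s i x l := fun x l hl => by simp [hl]
      have h2 : ∀ x, ∀ l, l ≠ i → Function.update s i x l = t l := fun x l hl => by
        simp [hl, h l hl]
      simp only [site, if_pos h, if_pos (h1 _), if_pos (h2 _), Function.update_self,
        Matrix.mul_apply]
    · have h2 : ∀ x, ¬ ∀ l, l ≠ i → Function.update s i x l = t l := fun x h2 => h fun l hl => by
        rw [← h2 l hl]; simp [hl]
      simp only [site, if_neg h, if_neg (h2 _), mul_zero, Finset.sum_const_zero]
  · intro r hr
    have : ¬ ∀ l, l ≠ i → s l = r l := fun h => hr ⟨r i, by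
      ext l; by_cases hl : l = i
      · subst hl; simp
      · simp [hl, h l hl]⟩
    simp [site, if_neg this]
  · intro x; rfl

theorem site_mul_site_apply {i k : ι} (hik : i ≠ k) (A B : Matrix (Fin 2) (Fin 2) ℂ)
    (s t : ι → Fin 2) :
    (site i A * site k B) s t =
      if ∀ l, l ≠ i → l ≠ k → s l = t l then A (s i) (t i) * B (s k) (t k) else 0 := by
  rw [Matrix.mul_apply, Finset.sum_eq_single (Function.update s i (t i))]
  · have h1 : ∀ l, l ≠ i → s l = Function.update s i (t i) l := fun l hl => by simp [hl]
    have h2 : (∀ l, l ≠ k → Function.update s i (t i) l = t l) ↔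
        ∀ l, l ≠ i → l ≠ k → s l = t l := by
      constructor
      · intro h l hi hk
        rw [← h l hk]; simp [hi]
      · intro h l hk
        by_cases hl : l = i
        · subst hl; simp
        · simp [hl, h l hl hk]
    simp only [site, if_pos h1, h2, Function.update_self, Function.update_of_ne hik.symm, mul_ite,
      mul_zero]
  · intro r _ hr
    by_contra h
    obtain ⟨h1, h2⟩ := mul_ne_zero_iff.mp h
    have h1' : ∀ l, l ≠ i → s l = r l := by
      by_contra h3; exact h1 (by simp only [site, if_neg h3])
    have h2' : ∀ l, l ≠ k → r l = t l := by
      by_contra h3; exact h2 (by simp only [site, if_neg h3])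
    apply hr
    ext l
    by_cases hl : l = i
    · subst hl; simp [h2' _ hik]
    · simp [hl, h1' l hl]
  · simp

theorem site_commute {i k : ι} (hik : i ≠ k) (A B : Matrix (Fin 2) (Fin 2) ℂ) :
    Commute (site i A) (site k B) := by
  ext s t
  rw [site_mul_site_apply hik, site_mul_site_apply hik.symm]
  have : (∀ l, l ≠ i → l ≠ k → s l = t l) ↔ (∀ l, l ≠ k → l ≠ i → s l = t l) :=
    ⟨fun h l h1 h2 => h l h2 h1, fun h l h1 h2 => h l h2 h1⟩
  simp only [this, mul_comm]

theorem site_conjTranspose (i : ι) (A : Matrix (Fin 2) (Fin 2) ℂ) : (site i A)ᴴ = site i Aᴴ := by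
  ext s t
  simp only [site, Matrix.conjTranspose_apply, eq_comm (a := t _)]
  split_ifs <;> simp

/-- `M` acts trivially on qubit `i`, expressed through the commutant: it commutes with every
operator on that qubit. -/
def TrivialAt (i : ι) (M : Matrix (ι → Fin 2) (ι → Fin 2) ℂ) : Prop :=
  ∀ A, Commute (site i A) M

namespace TrivialAt

variable {i k : ι} {M N : Matrix (ι → Fin 2) (ι → Fin 2) ℂ}

theorem one : TrivialAt i (1 : Matrix (ι → Fin 2) (ι → Fin 2) ℂ) := fun _ => Commute.one_right _

theorem mul (hM : TrivialAt i M) (hN : TrivialAt i N) : TrivialAt i (M * N) :=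
  fun A => (hM A).mul_right (hN A)

theorem add (hM : TrivialAt i M) (hN : TrivialAt i N) : TrivialAt i (M + N) :=
  fun A => (hM A).add_right (hN A)

theorem sub (hM : TrivialAt i M) (hN : TrivialAt i N) : TrivialAt i (M - N) :=
  fun A => (hM A).sub_right (hN A)

theorem smul (c : ℂ) (hM : TrivialAt i M) : TrivialAt i (c • M) :=
  fun A => (hM A).smul_right c

theorem sum {κ : Type*} {f : κ → Matrix (ι → Fin 2) (ι → Fin 2) ℂ} (s : Finset κ)
    (h : ∀ k ∈ s, TrivialAt i (f k)) : TrivialAt i (∑ k ∈ s, f k) :=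
  fun A => Commute.sum_right _ _ _ fun k hk => h k hk A

theorem lie (hM : TrivialAt i M) (hN : TrivialAt i N) : TrivialAt i ⁅M, N⁆ := by
  rw [Ring.lie_def]
  exact (hM.mul hN).sub (hN.mul hM)

theorem conjTranspose (hM : TrivialAt i M) : TrivialAt i Mᴴ := by
  intro A
  have h := congrArg Matrix.conjTranspose (hM Aᴴ).eq
  rw [Matrix.conjTranspose_mul, Matrix.conjTranspose_mul, site_conjTranspose,
    Matrix.conjTranspose_conjTranspose] at h
  exact h.symm

theorem site_of_ne (h : i ≠ k) (A : Matrix (Fin 2) (Fin 2) ℂ) : TrivialAt i (site k A) :=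
  fun B => site_commute h B A

end TrivialAt

/-- The normalised trace is a product state. A traceless `2 × 2` matrix is a sum of commutators,
and the trace of `[E, F]_i V` vanishes when `V` commutes with `E_i` and `F_i`. -/
theorem trace_site_mul {i : ι} {V : Matrix (ι → Fin 2) (ι → Fin 2) ℂ} (hV : TrivialAt i V)
    (A : Matrix (Fin 2) (Fin 2) ℂ) :
    (site i A * V).trace = A.trace / 2 * V.trace := by
  have key : ∀ E F : Matrix (Fin 2) (Fin 2) ℂ,
      (site i (E * F) * V).trace = (site i (F * E) * V).trace := by
    intro E F
    rw [site_mul, site_mul, mul_assoc, (hV F).eq, ← mul_assoc, Matrix.trace_mul_comm, mul_assoc]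
  have h1 := key !![1, 0; 0, 0] !![0, 1; 0, 0]
  have h2 := key !![0, 0; 0, 1] !![0, 0; 1, 0]
  have h3 := key !![0, 1; 0, 0] !![0, 0; 1, 0]
  have hA : A = (A.trace / 2) • (1 : Matrix (Fin 2) (Fin 2) ℂ)
      + ((A 0 0 - A 1 1) / 2) • (!![0, 1; 0, 0] * !![0, 0; 1, 0])
      + (-((A 0 0 - A 1 1) / 2)) • (!![0, 0; 1, 0] * !![0, 1; 0, 0])
      + A 0 1 • (!![1, 0; 0, 0] * !![0, 1; 0, 0])
      + (-A 0 1) • (!![0, 1; 0, 0] * !![1, 0; 0, 0])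
      + A 1 0 • (!![0, 0; 0, 1] * !![0, 0; 1, 0])
      + (-A 1 0) • (!![0, 0; 1, 0] * !![0, 0; 0, 1]) := by
    ext a b
    fin_cases a <;> fin_cases b <;> simp [Matrix.trace_fin_two] <;> ring
  conv_lhs => rw [hA]
  simp only [site_add, site_smul, site_one, add_mul, Matrix.trace_add, Matrix.smul_mul,
    Matrix.trace_smul, one_mul, smul_eq_mul, h1, h2, h3]
  ring

open scoped ComplexOrder in
/-- Linear independence of the Pauli matrices on qubit `i` over the operators trivial there. -/
theorem pauli_components_eq_zero {i : ι} {V₀ V₁ V₂ V₃ : Matrix (ι → Fin 2) (ι → Fin 2) ℂ}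
    (h₀ : TrivialAt i V₀) (h₁ : TrivialAt i V₁) (h₂ : TrivialAt i V₂) (h₃ : TrivialAt i V₃)
    (h : V₀ + site i σx * V₁ + site i σy * V₂ + site i σz * V₃ = 0) :
    V₀ = 0 ∧ V₁ = 0 ∧ V₂ = 0 ∧ V₃ = 0 := by
  have tr : ∀ P Q : Matrix (Fin 2) (Fin 2) ℂ, ∀ V W, TrivialAt i V → TrivialAt i W →
      (site i P * W * (site i Q * V)).trace = (P * Q).trace / 2 * (W * V).trace := by
    intro P Q V W hV hW
    rw [← trace_site_mul (hW.mul hV), site_mul, mul_assoc, ← mul_assoc W, ← (hW Q).eq]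
    simp only [mul_assoc]
  have h' : site i 1 * V₀ + site i σx * V₁ + site i σy * V₂ + site i σz * V₃ = 0 := by
    rwa [site_one, one_mul]
  have key : ∀ P : Matrix (Fin 2) (Fin 2) ℂ, ∀ W, TrivialAt i W →
      P.trace / 2 * (W * V₀).trace + (P * σx).trace / 2 * (W * V₁).trace
        + (P * σy).trace / 2 * (W * V₂).trace + (P * σz).trace / 2 * (W * V₃).trace = 0 := by
    intro P W hW
    have h2 := congrArg (fun M => (site i P * W * M).trace) h'
    simpa only [mul_add, Matrix.trace_add, tr P _ _ W h₀ hW, tr P _ _ W h₁ hW, tr P _ _ W h₂ hW,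
      tr P _ _ W h₃ hW, mul_one, mul_zero, Matrix.trace_zero] using h2
  refine ⟨?_, ?_, ?_, ?_⟩ <;> rw [← Matrix.trace_conjTranspose_mul_self_eq_zero_iff]
  · simpa [σx, σy, σz, Matrix.trace_fin_two] using key 1 _ h₀.conjTranspose
  · simpa [σx, σy, σz, Matrix.trace_fin_two] using key σx _ h₁.conjTranspose
  · simpa [σx, σy, σz, Matrix.trace_fin_two] using key σy _ h₂.conjTranspose
  · simpa [σx, σy, σz, Matrix.trace_fin_two] using key σz _ h₃.conjTranspose

end Site

/-! ### Two-site operators on the ring -/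

section Place

/-- Two-site operators are sums of product operators. -/
theorem twoSite_induction {p : TwoSiteOp → Prop} (hadd : ∀ b c, p b → p c → p (b + c))
    (hprod : ∀ A B : Matrix (Fin 2) (Fin 2) ℂ, p (A ⊗ₖ B)) (b : TwoSiteOp) : p b := by
  have h0 : p 0 := by simpa using hprod 0 0
  rw [Matrix.matrix_eq_sum_single b]
  refine Finset.sum_induction _ p hadd h0 fun i _ => Finset.sum_induction _ p hadd h0 fun j _ => ?_
  have := hprod (Matrix.single i.1 j.1 (b i j)) (Matrix.single i.2 j.2 1)
  rwa [Matrix.single_kronecker_single, mul_one] at this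

variable {n : ℕ} (j : ZMod n)

theorem place_add (b c : TwoSiteOp) : place j (b + c) = place j b + place j c := by
  ext s t
  simp only [place, Matrix.add_apply]
  split_ifs <;> simp

theorem place_smul (c : ℂ) (b : TwoSiteOp) : place j (c • b) = c • place j b := by
  ext s t
  simp [place, Matrix.smul_apply]

theorem place_sub (b c : TwoSiteOp) : place j (b - c) = place j b - place j c := by
  ext s t
  simp only [place, Matrix.sub_apply]
  split_ifs <;> simp

theorem place_zero : place j 0 = 0 := by
  ext s t
  simp [place]

theorem place_sum {κ : Type*} (s : Finset κ) (f : κ → TwoSiteOp) :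
    place j (∑ k ∈ s, f k) = ∑ k ∈ s, place j (f k) :=
  map_sum (AddMonoidHom.mk' (place j) (place_add j)) f s

theorem place_conjTranspose (b : TwoSiteOp) : (place j b)ᴴ = place j bᴴ := by
  ext s t
  rw [Matrix.conjTranspose_apply]
  by_cases h : ∀ i, i ≠ j → i ≠ j + 1 → s i = t i
  · have h' : ∀ i, i ≠ j → i ≠ j + 1 → t i = s i := fun i hi hi' => (h i hi hi').symm
    simp only [place, if_pos h, if_pos h', Matrix.conjTranspose_apply]
  · have h' : ¬ ∀ i, i ≠ j → i ≠ j + 1 → t i = s i :=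
      fun h' => h fun i hi hi' => (h' i hi hi').symm
    simp only [place, if_neg h, if_neg h', star_zero]

variable [NeZero n] [Nontrivial (ZMod n)]

theorem place_kronecker (A B : Matrix (Fin 2) (Fin 2) ℂ) :
    place j (A ⊗ₖ B) = site j A * site (j + 1) B := by
  ext s t
  rw [site_mul_site_apply (by simp)]
  simp only [place, Matrix.kroneckerMap_apply]
  congr

theorem place_one : place j 1 = 1 := by
  rw [← Matrix.one_kronecker_one, place_kronecker, site_one, site_one, one_mul]

theorem place_mul (b c : TwoSiteOp) : place j (b * c) = place j b * place j c := by
  induction b using twoSite_induction with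
  | hadd b b' h h' => rw [add_mul, place_add, place_add, add_mul, h, h']
  | hprod A B =>
    induction c using twoSite_induction with
    | hadd c c' h h' => rw [mul_add, place_add, place_add, mul_add, h, h']
    | hprod C D =>
      rw [← Matrix.mul_kronecker_mul, place_kronecker, place_kronecker, place_kronecker, site_mul,
        site_mul, mul_assoc, mul_assoc, ← mul_assoc (site j C),
        (site_commute (by simp : j ≠ j + 1) C B).eq, mul_assoc]

theorem place_lie (b c : TwoSiteOp) : place j ⁅b, c⁆ = ⁅place j b, place j c⁆ := by
  rw [Ring.lie_def, Ring.lie_def, place_sub, place_mul, place_mul]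

theorem site_eq_place_left (A : Matrix (Fin 2) (Fin 2) ℂ) : site j A = place j (A ⊗ₖ 1) := by
  rw [place_kronecker, site_one, mul_one]

theorem site_eq_place_right (A : Matrix (Fin 2) (Fin 2) ℂ) :
    site (j + 1) A = place j (1 ⊗ₖ A) := by
  rw [place_kronecker, site_one, one_mul]

variable {j}

theorem trivialAt_place {i : ZMod n} (h : i ≠ j) (h' : i ≠ j + 1) (b : TwoSiteOp) :
    TrivialAt i (place j b) := by
  induction b using twoSite_induction with
  | hadd b c hb hc => rw [place_add]; exact hb.add hc
  | hprod A B =>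
    rw [place_kronecker]
    exact (TrivialAt.site_of_ne h A).mul (.site_of_ne h' B)

theorem place_commute {V : RingOp n} (h : TrivialAt j V) (h' : TrivialAt (j + 1) V)
    (b : TwoSiteOp) : Commute (place j b) V := by
  induction b using twoSite_induction with
  | hadd b c hb hc => rw [place_add]; exact hb.add_left hc
  | hprod A B => rw [place_kronecker]; exact (h A).mul_left (h' B)

theorem trace_place_mul {V : RingOp n} (h : TrivialAt j V) (h' : TrivialAt (j + 1) V)
    (b : TwoSiteOp) : (place j b * V).trace = b.trace / 4 * V.trace := by
  induction b using twoSite_induction with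
  | hadd b c hb hc =>
    rw [place_add, add_mul, Matrix.trace_add, hb, hc, Matrix.trace_add]; ring
  | hprod A B =>
    rw [place_kronecker, mul_assoc,
      trace_site_mul ((TrivialAt.site_of_ne (by simp) B).mul h), trace_site_mul h',
      Matrix.trace_kronecker]
    ring

omit [Nontrivial (ZMod n)] in
theorem trace_ringOp_one_ne_zero : (1 : RingOp n).trace ≠ 0 := by
  rw [Matrix.trace_one]
  exact_mod_cast Fintype.card_ne_zero

omit [NeZero n] in
/-- A placed two-site operator determines the two-site operator. -/
theorem place_eq_zero {b : TwoSiteOp} (h : place j b = 0) : b = 0 := by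
  ext p q
  let f : Fin 2 × Fin 2 → ZMod n → Fin 2 :=
    fun r i => if i = j then r.1 else if i = j + 1 then r.2 else 0
  have hf : ∀ i, i ≠ j → i ≠ j + 1 → f p i = f q i := fun i h1 h2 => by simp [f, h1, h2]
  have h1 := congrFun (congrFun h (f p)) (f q)
  simp only [place, if_pos hf] at h1
  simpa [f] using h1

end Place

/-! ### Lindblad generators -/

section Lindblad

section General

variable {ι : Type*} [Fintype ι] {m : ℕ}

theorem dissipator_sum {κ : Type*} (s : Finset κ) (L : Fin m → Matrix ι ι ℂ)
    (f : κ → Matrix ι ι ℂ) : dissipator L (∑ k ∈ s, f k) = ∑ k ∈ s, dissipator L (f k) := by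
  simp only [dissipator]
  rw [Finset.sum_comm]
  refine Finset.sum_congr rfl fun k _ => ?_
  simp only [Finset.mul_sum, Finset.sum_mul, Ring.lie_def, ← Finset.sum_sub_distrib,
    ← Finset.sum_add_distrib]

theorem lindblad_sum {κ : Type*} (s : Finset κ) (H : Matrix ι ι ℂ) (L : Fin m → Matrix ι ι ℂ)
    (f : κ → Matrix ι ι ℂ) : lindblad H L (∑ k ∈ s, f k) = ∑ k ∈ s, lindblad H L (f k) := by
  simp only [lindblad, dissipator_sum, Finset.sum_add_distrib, ← Finset.smul_sum, Ring.lie_def,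
    Finset.mul_sum, Finset.sum_mul, Finset.sum_sub_distrib]

theorem dissipator_one [DecidableEq ι] (L : Fin m → Matrix ι ι ℂ) :
    dissipator L 1 = (2 : ℂ) • ∑ k, ⁅L k, (L k)ᴴ⁆ := by
  simp [dissipator, ← Finset.sum_add_distrib, two_smul]

theorem dissipator_of_commute [DecidableEq ι] {L : Fin m → Matrix ι ι ℂ} {V : Matrix ι ι ℂ}
    (h : ∀ k, Commute (L k) V) (h' : ∀ k, Commute (L k)ᴴ V) :
    dissipator L V = dissipator L 1 * V := by
  simp only [dissipator, Finset.sum_mul, Ring.lie_def]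
  refine Finset.sum_congr rfl fun k _ => ?_
  have h1 : L k * V * (L k)ᴴ = L k * (L k)ᴴ * V := by rw [mul_assoc, ← (h' k).eq, mul_assoc]
  have h2 : V * (L k)ᴴ * L k = (L k)ᴴ * L k * V := by
    rw [← (h' k).eq, mul_assoc, ← (h k).eq, mul_assoc]
  have h3 : L k * (V * (L k)ᴴ) = L k * (L k)ᴴ * V := by rw [← mul_assoc, h1]
  rw [h1, h2, h3]
  noncomm_ring

/-- The energy identity behind the rigidity: for Hermitian `A`, the dissipator pairs with `A` to
minus the squared Hilbert–Schmidt norms of the commutators `[L k, A]`, up to a term which only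
sees the image of the identity. -/
theorem trace_mul_dissipator [DecidableEq ι] (L : Fin m → Matrix ι ι ℂ) {A : Matrix ι ι ℂ}
    (hA : Aᴴ = A) :
    (A * dissipator L A).trace =
      1 / 2 * (A * A * dissipator L 1).trace - ∑ k, (⁅L k, A⁆ᴴ * ⁅L k, A⁆).trace := by
  rw [dissipator_one, dissipator]
  simp only [Matrix.mul_smul, Matrix.trace_smul, Finset.mul_sum, Matrix.trace_sum, smul_eq_mul]
  rw [← Finset.sum_sub_distrib]
  refine Finset.sum_congr rfl fun k _ => ?_
  simp only [Ring.lie_def, Matrix.conjTranspose_sub, Matrix.conjTranspose_mul, hA, mul_sub,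
    sub_mul, mul_add, Matrix.trace_sub, Matrix.trace_add]
  have e2 := Matrix.trace_mul_comm (A * (L k)ᴴ) (A * L k)
  have e3 := Matrix.trace_mul_comm (L k)ᴴ (A * L k * A)
  have e4 := Matrix.trace_mul_comm (L k)ᴴ (A * A * L k)
  simp only [mul_assoc] at e2 e3 e4 ⊢
  linear_combination e4 - e2 - e3

theorem trace_mul_lie_self (A H : Matrix ι ι ℂ) : (A * ⁅A, H⁆).trace = 0 := by
  rw [Ring.lie_def, mul_sub, Matrix.trace_sub, ← mul_assoc, ← mul_assoc,
    Matrix.trace_mul_comm (A * H) A, mul_assoc, sub_self]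

end General

variable {n : ℕ} [NeZero n] [Nontrivial (ZMod n)] {m : ℕ}

theorem place_dissipator (j : ZMod n) (L : Fin m → TwoSiteOp) (ρ : TwoSiteOp) :
    place j (dissipator L ρ) = dissipator (fun k => place j (L k)) (place j ρ) := by
  simp only [dissipator, place_sum, place_add, place_lie, place_mul, place_conjTranspose]

namespace TwoSiteLiouvillian

variable (𝓛 : TwoSiteLiouvillian) {j i : ZMod n}

omit [Nontrivial (ZMod n)] in
theorem term_sum {κ : Type*} (s : Finset κ) (f : κ → RingOp n) :
    𝓛.term j (∑ l ∈ s, f l) = ∑ l ∈ s, 𝓛.term j (f l) :=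
  lindblad_sum s _ _ f

theorem trivialAt_term {ρ : RingOp n} (h : i ≠ j) (h' : i ≠ j + 1) (hρ : TrivialAt i ρ) :
    TrivialAt i (𝓛.term j ρ) := by
  have hp := fun b => trivialAt_place h h' b
  unfold term lindblad dissipator
  refine ((hρ.lie (hp _)).smul _).add (TrivialAt.sum _ fun k _ => ?_)
  exact (((hp _).mul hρ).lie (hp _).conjTranspose).add
    ((hp _).lie (hρ.mul (hp _).conjTranspose))

/-- Away from its own sites, `𝓛_j` multiplies by the image of the identity. -/
theorem term_eq_mul {V : RingOp n} (h : TrivialAt j V) (h' : TrivialAt (j + 1) V) :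
    𝓛.term j V = place j (dissipator 𝓛.L 1) * V := by
  have hc := fun b => place_commute h h' b
  unfold term lindblad
  rw [Ring.lie_def, (hc _).eq, sub_self, smul_zero, zero_add,
    dissipator_of_commute (fun _ => hc _) (fun _ => place_conjTranspose j _ ▸ hc _),
    place_dissipator, place_one]

end TwoSiteLiouvillian

theorem trace_place_mul_place {j k : ZMod n} (h₁ : k ≠ j) (h₂ : k ≠ j + 1) (h₃ : k + 1 ≠ j)
    (p x b c : TwoSiteOp) :
    (place j p * place k x * (place j b * place k c)).trace =
      (p * b).trace / 4 * ((x * c).trace / 4 * (1 : RingOp n).trace) := by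
  have h₄ : k + 1 ≠ j + 1 := fun h => h₁ (add_right_cancel h)
  have t : ∀ d, TrivialAt j (place k d) := fun d => trivialAt_place h₁.symm h₃.symm d
  have t' : ∀ d, TrivialAt (j + 1) (place k d) := fun d => trivialAt_place h₂.symm h₄.symm d
  rw [← trace_place_mul .one .one, mul_one, ← trace_place_mul (t _) (t' _), place_mul, place_mul,
    mul_assoc, ← mul_assoc (place k x), ← (place_commute (t x) (t' x) b).eq]
  simp only [mul_assoc]

/-- If `S` is traceless at a qubit where `M` acts trivially, it does not see `M`. -/
theorem trace_mul_eq_zero {ι : Type*} [Fintype ι] [DecidableEq ι] {i : ι}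
    {S S' M : Matrix (ι → Fin 2) (ι → Fin 2) ℂ} {P : Matrix (Fin 2) (Fin 2) ℂ}
    (hS : S = site i P * S') (hP : P.trace = 0) (hS' : TrivialAt i S') (hM : TrivialAt i M) :
    (S * M).trace = 0 := by
  rw [hS, mul_assoc, trace_site_mul (hS'.mul hM), hP, zero_div, zero_mul]

end Lindblad

/-! ### Conservation forces the image of the identity to vanish -/

section Rigidity

theorem trace_σx : σx.trace = 0 := by simp [σx, Matrix.trace_fin_two]

theorem trace_canonical_XX (μ ν hx hy hz : ℝ) :
    ((σx ⊗ₖ σx) * canonicalInteraction μ ν hx hy hz).trace = 4 := by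
  simp [canonicalInteraction, σx, σy, σz, Matrix.trace, Matrix.mul_apply, Fintype.sum_prod_type,
    Matrix.one_apply]
  ring

theorem conjTranspose_canonical (μ ν hx hy hz : ℝ) :
    (canonicalInteraction μ ν hx hy hz)ᴴ = canonicalInteraction μ ν hx hy hz := by
  have h1 : σxᴴ = σx := by ext i j; fin_cases i <;> fin_cases j <;> simp [σx]
  have h2 : σyᴴ = σy := by ext i j; fin_cases i <;> fin_cases j <;> simp [σy]
  have h3 : σzᴴ = σz := by ext i j; fin_cases i <;> fin_cases j <;> simp [σz]
  simp [canonicalInteraction, Matrix.conjTranspose_kronecker, Matrix.conjTranspose_smul, h1, h2, h3]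

/-- The vanishing of the components of `q` obtained from the test operators below leaves only a
telescoping difference of one-site operators. -/
theorem exists_eq_sub_of_trace {q : TwoSiteOp} (h0 : q.trace = 0)
    (h2 : ∀ P Q : Matrix (Fin 2) (Fin 2) ℂ, P.trace = 0 → Q.trace = 0 →
      ((P ⊗ₖ Q) * q).trace = 0)
    (h1 : ∀ P : Matrix (Fin 2) (Fin 2) ℂ, P.trace = 0 →
      ((1 ⊗ₖ P) * q).trace + ((P ⊗ₖ 1) * q).trace = 0) :
    ∃ u : Matrix (Fin 2) (Fin 2) ℂ, q = u ⊗ₖ 1 - 1 ⊗ₖ u := by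
  have tx : (!![0, 1; 0, 0] : Matrix (Fin 2) (Fin 2) ℂ).trace = 0 := by simp [Matrix.trace_fin_two]
  have ty : (!![0, 0; 1, 0] : Matrix (Fin 2) (Fin 2) ℂ).trace = 0 := by simp [Matrix.trace_fin_two]
  have tz : (!![1, 0; 0, -1] : Matrix (Fin 2) (Fin 2) ℂ).trace = 0 := by
    simp [Matrix.trace_fin_two]
  have a1 := h1 _ tx
  have a2 := h1 _ ty
  have a3 := h1 _ tz
  have b1 := h2 _ _ tx tx
  have b2 := h2 _ _ tx ty
  have b3 := h2 _ _ tx tz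
  have b4 := h2 _ _ ty tx
  have b5 := h2 _ _ ty ty
  have b6 := h2 _ _ ty tz
  have b7 := h2 _ _ tz tx
  have b8 := h2 _ _ tz ty
  have b9 := h2 _ _ tz tz
  simp [Matrix.trace, Matrix.mul_apply, Fintype.sum_prod_type, Matrix.one_apply] at *
  -- `u` is half the partial trace of `q` over the second site.
  refine ⟨Matrix.of fun i j => (q (i, 0) (j, 0) + q (i, 1) (j, 1)) / 2, ?_⟩
  clear h1 h2 tx ty tz
  ext ⟨i, k⟩ ⟨j, l⟩
  fin_cases i <;> fin_cases j <;> fin_cases k <;> fin_cases l <;>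
    simp <;> grind

section Cover

variable {n : ℕ}

theorem ne_zero_of_five_le (hn : 5 ≤ n) :
    (1 : ZMod n) ≠ 0 ∧ (2 : ZMod n) ≠ 0 ∧ (3 : ZMod n) ≠ 0 ∧ (4 : ZMod n) ≠ 0 := by
  have key : ∀ k : ℕ, 0 < k → k < 5 → (k : ZMod n) ≠ 0 := fun k h1 h2 h3 =>
    absurd (Nat.le_of_dvd h1 ((ZMod.natCast_eq_zero_iff k n).mp h3)) (by omega)
  exact ⟨by simpa using key 1, by simpa using key 2, by simpa using key 3, by simpa using key 4⟩

/-- Two edges `{m, m + e}` and `{l, l + e}` which together cover `0`, `e` and `3 * e`. -/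
theorem edges_of_cover {R : Type*} [CommRing R] {e m l : R} (h1 : e ≠ 0) (h2 : 2 * e ≠ 0)
    (h3 : 3 * e ≠ 0) (h4 : 4 * e ≠ 0)
    (c0 : 0 = m ∨ 0 = m + e ∨ 0 = l ∨ 0 = l + e)
    (c1 : e = m ∨ e = m + e ∨ e = l ∨ e = l + e)
    (c3 : 3 * e = m ∨ 3 * e = m + e ∨ 3 * e = l ∨ 3 * e = l + e) :
    (m = 0 ∧ l = 2 * e) ∨ (m = 2 * e ∧ l = 0) ∨ (m = 0 ∧ l = 3 * e) ∨ (m = 3 * e ∧ l = 0) := by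
  have e0 : m = 0 ∨ m = -e ∨ l = 0 ∨ l = -e := by grind
  clear c0
  rcases e0 with rfl | rfl | rfl | rfl <;> grind

theorem exists_uncovered_of_three (hn : 5 ≤ n) {m l : ZMod n}
    (h : (m, l) ≠ (0, 2) ∧ (m, l) ≠ (2, 0) ∧ (m, l) ≠ (0, 3) ∧ (m, l) ≠ (3, 0)) :
    ∃ i : ZMod n, (i = 0 ∨ i = 1 ∨ i = 3) ∧ i ≠ m ∧ i ≠ m + 1 ∧ i ≠ l ∧ i ≠ l + 1 := by
  obtain ⟨h1, h2, h3, h4⟩ := ne_zero_of_five_le hn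
  by_contra hc
  have c : ∀ i : ZMod n, (i = 0 ∨ i = 1 ∨ i = 3) → i = m ∨ i = m + 1 ∨ i = l ∨ i = l + 1 := by
    intro i hi
    by_contra h5
    push Not at h5
    exact hc ⟨i, hi, h5⟩
  have := edges_of_cover (e := (1 : ZMod n)) h1 (by simpa using h2) (by simpa using h3)
    (by simpa using h4) (c 0 (by simp)) (c 1 (by simp)) (by simpa using c 3 (by simp))
  simp only [mul_one] at this
  simp only [ne_eq, Prod.mk.injEq] at h
  tauto

theorem exists_uncovered_of_four (hn : 5 ≤ n) {m l : ZMod n}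
    (h : (m, l) ≠ (0, 2) ∧ (m, l) ≠ (2, 0)) :
    ∃ i : ZMod n, (i = 0 ∨ i = 1 ∨ i = 2 ∨ i = 3) ∧ i ≠ m ∧ i ≠ m + 1 ∧ i ≠ l ∧ i ≠ l + 1 := by
  obtain ⟨h1, h2, h3, h4⟩ := ne_zero_of_five_le hn
  have d20 : (2 : ZMod n) ≠ 0 + 1 := fun h => h1 (by linear_combination h)
  have d23 : (2 : ZMod n) ≠ 3 := fun h => h1 (by linear_combination -h)
  have d24 : (2 : ZMod n) ≠ 3 + 1 := fun h => h2 (by linear_combination -h)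
  by_cases h5 : (m, l) = (0, 3)
  · obtain ⟨rfl, rfl⟩ := Prod.mk.inj h5
    exact ⟨2, by simp, h2, d20, d23, d24⟩
  by_cases h6 : (m, l) = (3, 0)
  · obtain ⟨rfl, rfl⟩ := Prod.mk.inj h6
    exact ⟨2, by simp, d23, d24, h2, d20⟩
  obtain ⟨i, hi, hi'⟩ := exists_uncovered_of_three hn ⟨h.1, h.2, h5, h6⟩
  exact ⟨i, by tauto, hi'⟩

end Cover

namespace TwoSiteLiouvillian

variable {n : ℕ} [NeZero n] {𝓛 : TwoSiteLiouvillian} {μ ν hx hy hz : ℝ}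

theorem sum_trace_eq_zero {a : TwoSiteOp} (h : 𝓛.GloballyConserves n a) (S : RingOp n) :
    ∑ p : ZMod n × ZMod n, (S * 𝓛.term p.1 (place p.2 a)).trace = 0 := by
  have h' := congrArg (fun M => (S * M).trace) (show _ = _ from h)
  simpa only [term_sum, Finset.mul_sum, Matrix.trace_sum, mul_zero, Matrix.trace_zero,
    Fintype.sum_prod_type] using h'

variable [Nontrivial (ZMod n)]

/-- On two disjoint, adjacent pairs of sites the conservation law pairs `q = 𝓛 1` with the
interaction; testing against a product of four traceless one-site operators isolates `q`. -/
theorem trace_kronecker_mul_eq_zero (hn : 5 ≤ n)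
    (h : 𝓛.GloballyConserves n (canonicalInteraction μ ν hx hy hz))
    {P Q : Matrix (Fin 2) (Fin 2) ℂ} (hP : P.trace = 0) (hQ : Q.trace = 0) :
    ((P ⊗ₖ Q) * dissipator 𝓛.L 1).trace = 0 := by
  obtain ⟨h1, h2, h3, h4⟩ := ne_zero_of_five_le hn
  have d01 : (0 : ZMod n) ≠ 1 := fun h => h1 (by linear_combination -h)
  have d02 : (0 : ZMod n) ≠ 2 := fun h => h2 (by linear_combination -h)
  have d03 : (0 : ZMod n) ≠ 3 := fun h => h3 (by linear_combination -h)
  have d12 : (1 : ZMod n) ≠ 2 := fun h => h1 (by linear_combination -h)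
  have d13 : (1 : ZMod n) ≠ 3 := fun h => h2 (by linear_combination -h)
  have d23 : (2 : ZMod n) ≠ 3 := fun h => h1 (by linear_combination -h)
  have e1 : (0 : ZMod n) + 1 = 1 := zero_add 1
  have e3 : (2 : ZMod n) + 1 = 3 := by norm_num
  have key : ∀ P Q : Matrix (Fin 2) (Fin 2) ℂ, P.trace = 0 → Q.trace = 0 →
      ((P ⊗ₖ Q) * dissipator 𝓛.L 1).trace *
          ((σx ⊗ₖ σx) * canonicalInteraction μ ν hx hy hz).trace
        + ((P ⊗ₖ Q) * canonicalInteraction μ ν hx hy hz).trace *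
          ((σx ⊗ₖ σx) * dissipator 𝓛.L 1).trace = 0 := by
    intro P Q hP hQ
    have hsum := sum_trace_eq_zero h (place 0 (P ⊗ₖ Q) * place 2 (σx ⊗ₖ σx))
    have hne : ((0, 2) : ZMod n × ZMod n) ≠ (2, 0) := by simp [h2]
    rw [Fintype.sum_eq_add _ _ hne] at hsum
    · dsimp only at hsum
      have c : ∀ b c : TwoSiteOp, Commute (place (0 : ZMod n) b) (place 2 c) := fun b c =>
        place_commute (trivialAt_place d02 (e3 ▸ d03) c)
          (e1.symm ▸ trivialAt_place d12 (e3 ▸ d13) c) b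
      rw [term_eq_mul _ (trivialAt_place d02 (e3 ▸ d03) _)
          (e1.symm ▸ trivialAt_place d12 (e3 ▸ d13) _),
        term_eq_mul _ (trivialAt_place d02.symm (e1.symm ▸ d12.symm) _)
          (e3.symm ▸ trivialAt_place d03.symm (e1.symm ▸ d13.symm) _), ← (c _ _).eq,
        trace_place_mul_place d02.symm (e1.symm ▸ d12.symm) (e3.symm ▸ d03.symm),
        trace_place_mul_place d02.symm (e1.symm ▸ d12.symm) (e3.symm ▸ d03.symm)] at hsum
      have := trace_ringOp_one_ne_zero (n := n)
      have h16 : (1 : RingOp n).trace / 16 ≠ 0 := div_ne_zero this (by norm_num)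
      apply mul_right_cancel₀ h16
      linear_combination hsum
    · rintro ⟨m, l⟩ hml
      obtain ⟨i, hi, him, him', hil, hil'⟩ := exists_uncovered_of_four hn hml
      have hM := 𝓛.trivialAt_term him him'
        (trivialAt_place hil hil' (canonicalInteraction μ ν hx hy hz))
      have t := fun {i k : ZMod n} (hik : i ≠ k) A => TrivialAt.site_of_ne hik A
      rw [place_kronecker, place_kronecker, e1, e3]
      rcases hi with rfl | rfl | rfl | rfl
      · exact trace_mul_eq_zero (mul_assoc _ _ _) hP
          ((t d01 _).mul ((t d02 _).mul (t d03 _))) hM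
      · exact trace_mul_eq_zero (by rw [(t d01 Q P).eq, mul_assoc]) hQ
          ((t d01.symm _).mul ((t d12 _).mul (t d13 _))) hM
      · exact trace_mul_eq_zero
          (by rw [← mul_assoc, ← (((t d02.symm P).mul (t d12.symm Q)) σx).eq, mul_assoc]) trace_σx
          (((t d02.symm _).mul (t d12.symm _)).mul (t d23 _)) hM
      · exact trace_mul_eq_zero
          (by rw [← mul_assoc,
            ← ((((t d03.symm P).mul (t d13.symm Q)).mul (t d23.symm σx)) σx).eq]) trace_σx
          (((t d03.symm _).mul (t d13.symm _)).mul (t d23.symm _)) hM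
  -- `a` has the component `1` along `σx ⊗ σx`, so that first this component of `q` vanishes and
  -- then every other one.
  have hXX := key σx σx trace_σx trace_σx
  have hPQ := key P Q hP hQ
  rw [trace_canonical_XX] at hXX hPQ
  have : ((σx ⊗ₖ σx) * dissipator 𝓛.L 1).trace = 0 := by linear_combination hXX / 8
  rw [this] at hPQ
  linear_combination hPQ / 4

/-- The one-site part of `q = 𝓛 1`, isolated by a test operator on an edge and a site adjacent
to neither of its ends. -/
theorem trace_one_kronecker_add_eq_zero (hn : 5 ≤ n)
    (h : 𝓛.GloballyConserves n (canonicalInteraction μ ν hx hy hz))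
    {P : Matrix (Fin 2) (Fin 2) ℂ} (hP : P.trace = 0) :
    ((1 ⊗ₖ P) * dissipator 𝓛.L 1).trace + ((P ⊗ₖ 1) * dissipator 𝓛.L 1).trace = 0 := by
  obtain ⟨h1, h2, h3, h4⟩ := ne_zero_of_five_le hn
  have d01 : (0 : ZMod n) ≠ 1 := fun h => h1 (by linear_combination -h)
  have d02 : (0 : ZMod n) ≠ 2 := fun h => h2 (by linear_combination -h)
  have d03 : (0 : ZMod n) ≠ 3 := fun h => h3 (by linear_combination -h)
  have d12 : (1 : ZMod n) ≠ 2 := fun h => h1 (by linear_combination -h)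
  have d13 : (1 : ZMod n) ≠ 3 := fun h => h2 (by linear_combination -h)
  have d23 : (2 : ZMod n) ≠ 3 := fun h => h1 (by linear_combination -h)
  have e1 : (0 : ZMod n) + 1 = 1 := zero_add 1
  have e3 : (2 : ZMod n) + 1 = 3 := by norm_num
  have e4 : (3 : ZMod n) + 1 = 4 := by norm_num
  have hXX := trace_kronecker_mul_eq_zero hn h trace_σx trace_σx
  have hS2 : site 3 P = place (2 : ZMod n) (1 ⊗ₖ P) := by rw [← site_eq_place_right, e3]
  have hS3 : site 3 P = place (3 : ZMod n) (P ⊗ₖ 1) := site_eq_place_left 3 P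
  -- An edge `{k, k + 1}` containing the site `3` is disjoint from the edge `{0, 1}`.
  have pair : ∀ k : ZMod n, k ≠ 0 → k ≠ 1 → k + 1 ≠ 0 → ∀ x : TwoSiteOp, site 3 P = place k x →
      (place 0 (σx ⊗ₖ σx) * site 3 P *
        𝓛.term 0 (place k (canonicalInteraction μ ν hx hy hz))).trace = 0 ∧
      (place 0 (σx ⊗ₖ σx) * site 3 P *
        𝓛.term k (place 0 (canonicalInteraction μ ν hx hy hz))).trace =
        (x * dissipator 𝓛.L 1).trace / 4 * (1 : RingOp n).trace := by
    intro k hk0 hk1 hk x hx'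
    have hk' : k + 1 ≠ 1 := fun h => hk0 (by linear_combination h)
    have t0 : ∀ c : TwoSiteOp, TrivialAt 0 (place k c) := trivialAt_place hk0.symm hk.symm
    have t1 : ∀ c : TwoSiteOp, TrivialAt (0 + 1) (place k c) :=
      e1.symm ▸ trivialAt_place hk1.symm hk'.symm
    rw [hx', term_eq_mul _ (t0 _) (t1 _),
      term_eq_mul _ (trivialAt_place hk0 (e1.symm ▸ hk1) _)
        (trivialAt_place hk (e1.symm ▸ hk') _), ← (place_commute (t0 _) (t1 _) _).eq,
      trace_place_mul_place hk0 (e1.symm ▸ hk1) hk,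
      trace_place_mul_place hk0 (e1.symm ▸ hk1) hk, hXX, trace_canonical_XX]
    constructor <;> ring
  have p2 := pair 2 h2 d12.symm (e3.symm ▸ h3) _ hS2
  have p3 := pair 3 h3 d13.symm (e4.symm ▸ h4) _ hS3
  have hsum := sum_trace_eq_zero h (place 0 (σx ⊗ₖ σx) * site 3 P)
  rw [← Finset.sum_subset (Finset.subset_univ
    {((0 : ZMod n), (2 : ZMod n)), (2, 0), (0, 3), (3, 0)})] at hsum
  · rw [Finset.sum_insert (by simp [d02, d23, d03]), Finset.sum_insert (by simp [h2, d23]),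
      Finset.sum_insert (by simp [d03]), Finset.sum_singleton] at hsum
    dsimp only at hsum
    rw [p2.1, p2.2, p3.1, p3.2] at hsum
    apply mul_right_cancel₀
      (div_ne_zero (trace_ringOp_one_ne_zero (n := n)) (by norm_num : (4 : ℂ) ≠ 0))
    linear_combination hsum
  · rintro ⟨m, l⟩ - hml
    simp only [Finset.mem_insert, Finset.mem_singleton, not_or] at hml
    obtain ⟨i, hi, him, him', hil, hil'⟩ := exists_uncovered_of_three hn hml
    have hM := 𝓛.trivialAt_term him him'
      (trivialAt_place hil hil' (canonicalInteraction μ ν hx hy hz))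
    have t := fun {i k : ZMod n} (hik : i ≠ k) A => TrivialAt.site_of_ne hik A
    rw [place_kronecker, e1]
    rcases hi with rfl | rfl | rfl
    · exact trace_mul_eq_zero (mul_assoc _ _ _) trace_σx ((t d01 _).mul (t d03 _)) hM
    · exact trace_mul_eq_zero (by rw [(t d01 σx σx).eq, mul_assoc]) trace_σx
        ((t d01.symm _).mul (t d13 _)) hM
    · exact trace_mul_eq_zero (by rw [← ((t d03.symm σx).mul (t d13.symm σx) P).eq]) hP
        ((t d03.symm _).mul (t d13.symm _)) hM

/-- Global conservation makes `𝓛` unital on the ring. -/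
theorem sum_place_dissipator_one (hn : 5 ≤ n)
    (h : 𝓛.GloballyConserves n (canonicalInteraction μ ν hx hy hz)) :
    ∑ j : ZMod n, place j (dissipator 𝓛.L 1) = 0 := by
  have h0 : (dissipator 𝓛.L 1).trace = 0 := by
    simp [dissipator_one, Ring.lie_def, Matrix.trace_sum, Matrix.trace_mul_comm (𝓛.L _)]
  obtain ⟨u, hu⟩ := exists_eq_sub_of_trace h0
    (fun P Q hP hQ => trace_kronecker_mul_eq_zero hn h hP hQ)
    (fun P hP => trace_one_kronecker_add_eq_zero hn h hP)
  simp only [hu, place_sub, ← site_eq_place_left, ← site_eq_place_right, Finset.sum_sub_distrib]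
  rw [sub_eq_zero]
  exact (Equiv.sum_comp (Equiv.addRight (1 : ZMod n)) fun j => site j u).symm

open scoped ComplexOrder in
/-- Pairing the conservation law with the conserved operator itself gives a vanishing sum of
squared norms of commutators. -/
theorem lie_place_eq_zero (hn : 5 ≤ n)
    (h : 𝓛.GloballyConserves n (canonicalInteraction μ ν hx hy hz)) (j : ZMod n) (k : Fin 𝓛.m) :
    ⁅place j (𝓛.L k), ∑ l : ZMod n, place l (canonicalInteraction μ ν hx hy hz)⁆ = 0 := by
  set A : RingOp n := ∑ l : ZMod n, place l (canonicalInteraction μ ν hx hy hz) with hAdef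
  have hA : Aᴴ = A := by
    rw [hAdef, Matrix.conjTranspose_sum]
    simp only [place_conjTranspose, conjTranspose_canonical]
  have hsum : ∑ j : ZMod n, (A * 𝓛.term j A).trace = 0 := by
    have := congrArg (fun M => (A * M).trace) (show _ = _ from h)
    simpa only [Finset.mul_sum, Matrix.trace_sum, mul_zero, Matrix.trace_zero] using this
  have hq : ∑ j : ZMod n,
      (A * A * dissipator (fun k => place j (𝓛.L k)) (1 : RingOp n)).trace = 0 := by
    have hd : ∀ j : ZMod n, dissipator (fun k => place j (𝓛.L k)) (1 : RingOp n) =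
        place j (dissipator 𝓛.L 1) := fun j => by rw [place_dissipator, place_one]
    simp only [hd, ← Matrix.trace_sum, ← Finset.mul_sum]
    rw [sum_place_dissipator_one hn h, mul_zero, Matrix.trace_zero]
  have hterm : ∀ j : ZMod n, (A * 𝓛.term j A).trace =
      1 / 2 * (A * A * dissipator (fun k => place j (𝓛.L k)) (1 : RingOp n)).trace
        - ∑ k, (⁅place j (𝓛.L k), A⁆ᴴ * ⁅place j (𝓛.L k), A⁆).trace := by
    intro j
    rw [term, lindblad, mul_add, Matrix.trace_add, Matrix.mul_smul, Matrix.trace_smul,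
      trace_mul_lie_self, smul_zero, zero_add, trace_mul_dissipator _ hA]
  have hnorm : ∑ j : ZMod n, ∑ k, (⁅place j (𝓛.L k), A⁆ᴴ * ⁅place j (𝓛.L k), A⁆).trace = 0 := by
    simp only [hterm, Finset.sum_sub_distrib, ← Finset.mul_sum, hq] at hsum
    simpa using hsum
  have nonneg : ∀ M : RingOp n, 0 ≤ (Mᴴ * M).trace := fun M =>
    (Matrix.posSemidef_conjTranspose_mul_self M).trace_nonneg
  rw [Finset.sum_eq_zero_iff_of_nonneg fun _ _ => Finset.sum_nonneg fun _ _ => nonneg _] at hnorm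
  have hj := hnorm j (Finset.mem_univ j)
  rw [Finset.sum_eq_zero_iff_of_nonneg fun _ _ => nonneg _] at hj
  exact Matrix.trace_conjTranspose_mul_self_eq_zero_iff.mp (hj k (Finset.mem_univ k))

end TwoSiteLiouvillian
end Rigidity

/-! ### Operators commuting with the interaction on the whole ring -/

section Commutant

/-- The one-site field of the interaction. -/
def oneSiteField (hx hy hz : ℝ) : Matrix (Fin 2) (Fin 2) ℂ :=
  (hx : ℂ) • σx + (hy : ℂ) • σy + (hz : ℂ) • σz

variable {n : ℕ} [NeZero n] [Nontrivial (ZMod n)] {μ ν hx hy hz : ℝ}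

theorem place_canonical (j : ZMod n) :
    place j (canonicalInteraction μ ν hx hy hz) =
      site j σx * site (j + 1) σx + (μ : ℂ) • (site j σy * site (j + 1) σy)
        + (ν : ℂ) • (site j σz * site (j + 1) σz)
        + site j (oneSiteField hx hy hz) + site (j + 1) (oneSiteField hx hy hz) := by
  simp only [canonicalInteraction, oneSiteField, place_add, place_smul, place_kronecker, site_one,
    mul_one, one_mul]

theorem ring_lie_add {R : Type*} [Ring R] (x y z : R) : ⁅x, y + z⁆ = ⁅x, y⁆ + ⁅x, z⁆ := by
  simp only [Ring.lie_def, mul_add, add_mul]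
  abel

theorem ring_lie_smul {R : Type*} [Ring R] [Algebra ℂ R] (c : ℂ) (x y : R) :
    ⁅x, c • y⁆ = c • ⁅x, y⁆ := by
  simp only [Ring.lie_def, mul_smul_comm, smul_mul_assoc, smul_sub]

theorem lie_mul_of_commute {R : Type*} [Ring R] {x y z : R} (h : Commute x y) :
    ⁅x, y * z⁆ = y * ⁅x, z⁆ := by
  rw [Ring.lie_def, Ring.lie_def, mul_sub, ← mul_assoc, h.eq, mul_assoc, mul_assoc]

/-- The commutator with the interaction on the edge to the left, in components at the outer
site. -/
theorem lie_place_left {j : ZMod n} (hj : j ≠ j + 1 + 1) (L : TwoSiteOp) :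
    ⁅place (j + 1) L, place j (canonicalInteraction μ ν hx hy hz)⁆ =
      place (j + 1) ⁅L, (oneSiteField hx hy hz ⊗ₖ 1 : TwoSiteOp)⁆
        + site j σx * place (j + 1) ⁅L, (σx ⊗ₖ 1 : TwoSiteOp)⁆
        + site j σy * place (j + 1) ((μ : ℂ) • ⁅L, (σy ⊗ₖ 1 : TwoSiteOp)⁆)
        + site j σz * place (j + 1) ((ν : ℂ) • ⁅L, (σz ⊗ₖ 1 : TwoSiteOp)⁆) := by
  have hc := fun A => (trivialAt_place (by simp : j ≠ j + 1) hj L A).symm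
  have hl : ∀ A, ⁅place (j + 1) L, site j A⁆ = 0 := fun A => sub_eq_zero.mpr (hc A).eq
  rw [place_canonical]
  simp only [ring_lie_add, ring_lie_smul, lie_mul_of_commute (hc _), hl, place_smul, place_lie,
    site_eq_place_left (j + 1), mul_smul_comm]
  abel

/-- The commutator with the interaction on the edge to the right, in components at the outer
site. -/
theorem lie_place_right {j : ZMod n} (hj : j + 1 + 1 ≠ j) (L : TwoSiteOp) :
    ⁅place j L, place (j + 1) (canonicalInteraction μ ν hx hy hz)⁆ =
      place j ⁅L, (1 ⊗ₖ oneSiteField hx hy hz : TwoSiteOp)⁆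
        + site (j + 1 + 1) σx * place j ⁅L, (1 ⊗ₖ σx : TwoSiteOp)⁆
        + site (j + 1 + 1) σy * place j ((μ : ℂ) • ⁅L, (1 ⊗ₖ σy : TwoSiteOp)⁆)
        + site (j + 1 + 1) σz * place j ((ν : ℂ) • ⁅L, (1 ⊗ₖ σz : TwoSiteOp)⁆) := by
  have hc := fun A => (trivialAt_place hj (by simp : j + 1 + 1 ≠ j + 1) L A).symm
  have hl : ∀ A, ⁅place j L, site (j + 1 + 1) A⁆ = 0 := fun A => sub_eq_zero.mpr (hc A).eq
  have hs := fun A B => (site_commute (by simp : j + 1 ≠ j + 1 + 1) A B).eq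
  rw [place_canonical]
  simp only [hs, ring_lie_add, ring_lie_smul, lie_mul_of_commute (hc _), hl, place_smul, place_lie,
    ← site_eq_place_right j, mul_smul_comm]
  abel

/-- Commutation of a placed operator with the global interaction, in components at the two sites
next to its support. The field of the two neighbouring edges adds to that of the edge itself. -/
theorem lie_components_eq_zero (hn : 5 ≤ n) {L : TwoSiteOp}
    (h : ∀ j : ZMod n,
      ⁅place j L, ∑ l : ZMod n, place l (canonicalInteraction μ ν hx hy hz)⁆ = 0) :
    (⁅L, (σx ⊗ₖ 1 : TwoSiteOp)⁆ = 0 ∧ (μ : ℂ) • ⁅L, (σy ⊗ₖ 1 : TwoSiteOp)⁆ = 0 ∧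
      (ν : ℂ) • ⁅L, (σz ⊗ₖ 1 : TwoSiteOp)⁆ = 0) ∧
    (⁅L, (1 ⊗ₖ σx : TwoSiteOp)⁆ = 0 ∧ (μ : ℂ) • ⁅L, (1 ⊗ₖ σy : TwoSiteOp)⁆ = 0 ∧
      (ν : ℂ) • ⁅L, (1 ⊗ₖ σz : TwoSiteOp)⁆ = 0) ∧
    ⁅L, canonicalInteraction μ ν hx hy hz + oneSiteField hx hy hz ⊗ₖ 1
      + 1 ⊗ₖ oneSiteField hx hy hz⁆ = 0 := by
  obtain ⟨h1, h2, h3, -⟩ := ne_zero_of_five_le hn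
  have d02 : (0 : ZMod n) ≠ 2 := fun h => h2 (by linear_combination -h)
  have d03 : (0 : ZMod n) ≠ 3 := fun h => h3 (by linear_combination -h)
  have d13 : (1 : ZMod n) ≠ 3 := fun h => h2 (by linear_combination -h)
  have d12 : (1 : ZMod n) ≠ 2 := fun h => h1 (by linear_combination -h)
  have d23 : (2 : ZMod n) ≠ 3 := fun h => h1 (by linear_combination -h)
  have e2 : (1 : ZMod n) + 1 = 2 := by norm_num
  have e3 : (2 : ZMod n) + 1 = 3 := by norm_num
  have tri := fun {i : ZMod n} (hi : i ≠ 1) (hi' : i ≠ 2) b =>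
    trivialAt_place (j := 1) hi (e2.symm ▸ hi') b
  -- The edge `{1, 2}` has the outer neighbours `0` and `3`, which are distinct.
  have hL := h 1
  rw [Ring.lie_def, Finset.mul_sum, Finset.sum_mul, ← Finset.sum_sub_distrib,
    ← Finset.sum_subset (Finset.subset_univ {(0 : ZMod n), 1, 2})] at hL
  · rw [Finset.sum_insert (by simp [d02, h1.symm]), Finset.sum_insert (by simp [d12]),
      Finset.sum_singleton, ← Ring.lie_def, ← Ring.lie_def, ← Ring.lie_def] at hL
    have hleft := lie_place_left (μ := μ) (ν := ν) (hx := hx) (hy := hy) (hz := hz)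
      (j := (0 : ZMod n))
      (by rwa [zero_add, e2]) L
    have hright := lie_place_right (μ := μ) (ν := ν) (hx := hx) (hy := hy) (hz := hz)
      (j := (1 : ZMod n)) (by rw [e2, e3]; exact d13.symm) L
    rw [zero_add] at hleft
    rw [e2, e3] at hright
    rw [hleft] at hL
    obtain ⟨hV, hX, hY, hZ⟩ := pauli_components_eq_zero (i := (0 : ZMod n))
      (V₀ := place 1 ⁅L, (oneSiteField hx hy hz ⊗ₖ 1 : TwoSiteOp)⁆ +
        (⁅place 1 L, place 1 (canonicalInteraction μ ν hx hy hz)⁆ +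
          ⁅place 1 L, place 2 (canonicalInteraction μ ν hx hy hz)⁆))
      (V₁ := place 1 ⁅L, (σx ⊗ₖ 1 : TwoSiteOp)⁆)
      (V₂ := place 1 ((μ : ℂ) • ⁅L, (σy ⊗ₖ 1 : TwoSiteOp)⁆))
      (V₃ := place 1 ((ν : ℂ) • ⁅L, (σz ⊗ₖ 1 : TwoSiteOp)⁆))
      ((tri h1.symm d02 _).add (((tri h1.symm d02 _).lie (tri h1.symm d02 _)).add
        ((tri h1.symm d02 _).lie (trivialAt_place d02 (e3 ▸ d03) _))))
      (tri h1.symm d02 _) (tri h1.symm d02 _) (tri h1.symm d02 _) (by rw [← hL]; abel)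
    rw [hright, ← place_lie] at hV
    obtain ⟨hV', hX', hY', hZ'⟩ := pauli_components_eq_zero (i := (3 : ZMod n))
      (V₀ := place 1 ⁅L, canonicalInteraction μ ν hx hy hz + oneSiteField hx hy hz ⊗ₖ 1
        + 1 ⊗ₖ oneSiteField hx hy hz⁆)
      (V₁ := place 1 ⁅L, (1 ⊗ₖ σx : TwoSiteOp)⁆)
      (V₂ := place 1 ((μ : ℂ) • ⁅L, (1 ⊗ₖ σy : TwoSiteOp)⁆))
      (V₃ := place 1 ((ν : ℂ) • ⁅L, (1 ⊗ₖ σz : TwoSiteOp)⁆))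
      (tri d13.symm d23.symm _) (tri d13.symm d23.symm _) (tri d13.symm d23.symm _)
      (tri d13.symm d23.symm _) (by
        rw [← hV, ring_lie_add, ring_lie_add, place_add, place_add]; abel)
    exact ⟨⟨place_eq_zero hX, place_eq_zero hY, place_eq_zero hZ⟩,
      ⟨place_eq_zero hX', place_eq_zero hY', place_eq_zero hZ'⟩, place_eq_zero hV'⟩
  · intro l _ hl
    simp only [Finset.mem_insert, Finset.mem_singleton, not_or] at hl
    rw [sub_eq_zero]
    refine (place_commute (trivialAt_place (Ne.symm hl.2.1) ?_ _) (trivialAt_place ?_ ?_ _) L).eq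
    · exact fun h => hl.1 (by linear_combination -h)
    · exact fun h => hl.2.2 (by linear_combination -h)
    · exact fun h => hl.2.1 (by linear_combination -h)

/-- A two-site operator commuting with `σx` on both sites is a combination of products of `1`
and `σx`. -/
theorem exists_eq_of_lie_σx {L : TwoSiteOp}
    (h₁ : ⁅L, (σx ⊗ₖ 1 : TwoSiteOp)⁆ = 0) (h₂ : ⁅L, (1 ⊗ₖ σx : TwoSiteOp)⁆ = 0) :
    ∃ c₀ c₁ c₂ c₃ : ℂ, L = c₀ • 1 + c₁ • (σx ⊗ₖ 1) + c₂ • (1 ⊗ₖ σx) + c₃ • (σx ⊗ₖ σx) := by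
  refine ⟨L (0, 0) (0, 0), L (1, 0) (0, 0), L (0, 1) (0, 0), L (1, 1) (0, 0), ?_⟩
  have e₁ : ∀ p q, ⁅L, (σx ⊗ₖ 1 : TwoSiteOp)⁆ p q = 0 := fun p q => by rw [h₁]; rfl
  have e₂ : ∀ p q, ⁅L, (1 ⊗ₖ σx : TwoSiteOp)⁆ p q = 0 := fun p q => by rw [h₂]; rfl
  simp only [Ring.lie_def, Matrix.sub_apply, Matrix.mul_apply, Fintype.sum_prod_type,
    Prod.forall, Fin.forall_fin_two, Fin.sum_univ_two, Matrix.kroneckerMap_apply, σx] at e₁ e₂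
  simp at e₁ e₂
  ext ⟨i, k⟩ ⟨j, l⟩
  fin_cases i <;> fin_cases j <;> fin_cases k <;> fin_cases l <;>
    simp [σx] <;> grind

end Commutant

section Classification

theorem oneSiteField_eq (hx hy hz : ℝ) :
    oneSiteField hx hy hz = !![(hz : ℂ), hx - hy * Complex.I; hx + hy * Complex.I, -hz] := by
  ext i j
  fin_cases i <;> fin_cases j <;> simp [oneSiteField, σx, σy, σz, sub_eq_add_neg]

/-- A traceless combination of products of `1` and `σx` commutes with a one-site operator `P` on
each site only if it vanishes, unless `P` commutes with `σx`. The two conditions on `P` state the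
two independent entries of `[σx, P]`. -/
theorem coeffs_eq_zero_of_lie {c₁ c₂ c₃ : ℂ} {P : Matrix (Fin 2) (Fin 2) ℂ}
    (hP : P 0 1 ≠ P 1 0 ∨ P 0 0 ≠ P 1 1) :
    let L : TwoSiteOp := c₁ • (σx ⊗ₖ 1) + c₂ • (1 ⊗ₖ σx) + c₃ • (σx ⊗ₖ σx)
    ⁅L, (P ⊗ₖ 1 : TwoSiteOp)⁆ = 0 → ⁅L, (1 ⊗ₖ P : TwoSiteOp)⁆ = 0 → c₁ = 0 ∧ c₂ = 0 ∧ c₃ = 0 := by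
  intro L h₁ h₂
  have e := fun p q => congrFun (congrFun h₁ p) q
  have f := fun p q => congrFun (congrFun h₂ p) q
  have e1 := e (0, 0) (0, 0)
  have e2 := e (0, 0) (1, 0)
  have e3 := e (0, 0) (0, 1)
  have e4 := e (0, 0) (1, 1)
  have f1 := f (0, 0) (0, 0)
  have f2 := f (0, 0) (0, 1)
  clear e f h₁ h₂
  simp [L, Ring.lie_def, Matrix.mul_apply, Fintype.sum_prod_type, σx] at e1 e2 e3 e4 f1 f2
  rcases hP with hP | hP <;> grind

theorem coeffs_eq_zero_of_field {c₁ c₂ c₃ : ℂ} {hx hy hz : ℝ} (hw : hy ≠ 0 ∨ hz ≠ 0) :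
    let L : TwoSiteOp := c₁ • (σx ⊗ₖ 1) + c₂ • (1 ⊗ₖ σx) + c₃ • (σx ⊗ₖ σx)
    ⁅L, canonicalInteraction 0 0 hx hy hz + oneSiteField hx hy hz ⊗ₖ 1
      + 1 ⊗ₖ oneSiteField hx hy hz⁆ = 0 → c₁ = 0 ∧ c₂ = 0 ∧ c₃ = 0 := by
  intro L h
  have ha : canonicalInteraction 0 0 hx hy hz =
      σx ⊗ₖ σx + oneSiteField hx hy hz ⊗ₖ 1 + 1 ⊗ₖ oneSiteField hx hy hz := by
    simp [canonicalInteraction, oneSiteField]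
  have hw' : (hy : ℂ) ≠ 0 ∨ (hz : ℂ) ≠ 0 := by exact_mod_cast hw
  have hI := Complex.I_ne_zero
  have e := fun p q => congrFun (congrFun h p) q
  have e1 := e (0, 0) (0, 0)
  have e2 := e (0, 1) (0, 1)
  have e3 := e (0, 0) (1, 0)
  have e4 := e (0, 1) (1, 1)
  have e5 := e (0, 0) (0, 1)
  have e6 := e (1, 0) (1, 1)
  have e7 := e (0, 0) (1, 1)
  clear e h
  simp [L, ha, oneSiteField_eq, Ring.lie_def, Matrix.mul_apply, Fintype.sum_prod_type, σx]
    at e1 e2 e3 e4 e5 e6 e7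
  clear_value L
  clear ha hw
  rcases hw' with hw | hw
  · have g1 : hy * Complex.I ≠ 0 := mul_ne_zero hw hI
    generalize (hy : ℂ) * Complex.I = y at *
    grind
  · generalize (hy : ℂ) * Complex.I = y at *
    grind

end Classification

namespace TwoSiteLiouvillian

theorem coefficients_eq_zero {n : ℕ} [NeZero n] (hn : 5 ≤ n) {μ ν hx hy hz : ℝ}
    {𝓛 : TwoSiteLiouvillian} (hD : dissipator 𝓛.L ≠ 0)
    (h : 𝓛.GloballyConserves n (canonicalInteraction μ ν hx hy hz)) :
    μ = 0 ∧ ν = 0 ∧ hy = 0 ∧ hz = 0 := by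
  have : Fact (1 < n) := ⟨by omega⟩
  obtain ⟨k, hk⟩ : ∃ k, 𝓛.L k ≠ 0 := by
    by_contra hL
    push Not at hL
    exact hD (by ext1 ρ; simp [dissipator, hL, Ring.lie_def])
  obtain ⟨⟨hX, hY, hZ⟩, ⟨hX', hY', hZ'⟩, hw⟩ :=
    lie_components_eq_zero hn fun j => lie_place_eq_zero hn h j k
  obtain ⟨c₀, c₁, c₂, c₃, hL⟩ := exists_eq_of_lie_σx hX hX'
  have hc₀ : c₀ = 0 := by
    have := 𝓛.trace_L k
    rw [hL] at this
    simpa [Matrix.trace_kronecker, trace_σx] using this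
  have hne : ¬ (c₁ = 0 ∧ c₂ = 0 ∧ c₃ = 0) := by
    rintro ⟨rfl, rfl, rfl⟩
    exact hk (by rw [hL, hc₀]; simp)
  rw [hc₀, zero_smul, zero_add] at hL
  rw [hL] at hY hZ hY' hZ' hw
  have hμ : μ = 0 := by
    by_contra hμ
    have hμ' : (μ : ℂ) ≠ 0 := by exact_mod_cast hμ
    refine hne (coeffs_eq_zero_of_lie (P := σy) (.inl ?_)
      ((smul_eq_zero_iff_right hμ').mp hY) ((smul_eq_zero_iff_right hμ').mp hY'))
    simp [σy, neg_eq_iff_add_eq_zero, ← two_mul]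
  have hν : ν = 0 := by
    by_contra hν
    have hν' : (ν : ℂ) ≠ 0 := by exact_mod_cast hν
    refine hne (coeffs_eq_zero_of_lie (P := σz) (.inr ?_)
      ((smul_eq_zero_iff_right hν').mp hZ) ((smul_eq_zero_iff_right hν').mp hZ'))
    simp only [σz, Matrix.of_apply, Matrix.cons_val]
    norm_num
  subst hμ hν
  refine ⟨rfl, rfl, ?_⟩
  by_contra hfield
  exact hne (coeffs_eq_zero_of_field (by tauto) hw)

/-! ### Dephasing along `σx` -/

/-- Dephasing along `σx`: no Hamiltonian, and the single Lindblad operator `σx ⊗ 1`. -/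
def dephasing : TwoSiteLiouvillian where
  H := 0
  isHermitian_H := Matrix.isHermitian_zero
  m := 1
  L := fun _ => σx ⊗ₖ 1
  trace_L := fun _ => by rw [Matrix.trace_kronecker, trace_σx, zero_mul]

theorem dissipator_dephasing_ne_zero : dissipator dephasing.L ≠ 0 := by
  intro h
  have : dissipator (fun _ : Fin 1 => (σx ⊗ₖ 1 : TwoSiteOp)) (σz ⊗ₖ 1) (0, 0) (0, 0) = 0 :=
    congrFun (congrFun (congrFun h (σz ⊗ₖ 1)) (0, 0)) (0, 0)
  simp [dissipator, Ring.lie_def, Matrix.mul_apply, Matrix.conjTranspose_kronecker,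
    Fintype.sum_prod_type, σx, σz] at this
  norm_num at this

theorem globallyConserves_dephasing {n : ℕ} [NeZero n] (hn : 2 ≤ n) (hx : ℝ) :
    dephasing.GloballyConserves n (canonicalInteraction 0 0 hx 0 0) := by
  have : Fact (1 < n) := ⟨by omega⟩
  have hXX : σx * σx = 1 := by
    ext i j; fin_cases i <;> fin_cases j <;> simp [σx]
  have hXs : σxᴴ = σx := by
    ext i j; fin_cases i <;> fin_cases j <;> simp [σx]
  have hc : ∀ i k : ZMod n, Commute (site i σx) (site k σx) := fun i k => by
    by_cases hik : i = k
    · rw [hik]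
    · exact site_commute hik _ _
  refine Finset.sum_eq_zero fun j _ => ?_
  have hA : Commute (site j σx) (∑ k : ZMod n, place k (canonicalInteraction 0 0 hx 0 0)) := by
    refine Commute.sum_right _ _ _ fun k _ => ?_
    have hf : oneSiteField hx 0 0 = (hx : ℂ) • σx := by simp [oneSiteField]
    rw [place_canonical, hf, site_smul, site_smul]
    simp only [Complex.ofReal_zero, zero_smul, add_zero]
    exact (((hc j k).mul_right (hc j _)).add_right ((hc j k).smul_right _)).add_right
      ((hc j _).smul_right _)
  unfold term lindblad
  have hL : ∀ k, place j (dephasing.L k) = site j σx := fun _ => (site_eq_place_left j σx).symm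
  have hH : place j dephasing.H = 0 := place_zero j
  simp only [hL, hH]
  rw [dissipator_of_commute (fun _ => hA) (fun _ => by rwa [site_conjTranspose, hXs]),
    dissipator_one]
  simp [Ring.lie_def, site_conjTranspose, hXs]

end TwoSiteLiouvillian

theorem mainTheorem4 (μ ν hx hy hz : ℝ) (hμ : μ ∈ Set.Icc (0 : ℝ) 1)
    (hν : ν ∈ Set.Icc (0 : ℝ) 1) :
    ((∃ 𝓛 : TwoSiteLiouvillian, dissipator 𝓛.L ≠ 0 ∧
        ∀ (n : ℕ) [NeZero n], 2 ≤ n →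
          𝓛.GloballyConserves n (canonicalInteraction μ ν hx hy hz)) ↔
      μ = 0 ∧ ν = 0 ∧ hy = 0 ∧ hz = 0) ∧
    (∀ (n : ℕ) [NeZero n], 5 ≤ n →
      ((∃ 𝓛 : TwoSiteLiouvillian, dissipator 𝓛.L ≠ 0 ∧
          𝓛.GloballyConserves n (canonicalInteraction μ ν hx hy hz)) ↔
        μ = 0 ∧ ν = 0 ∧ hy = 0 ∧ hz = 0)) := by
  refine ⟨⟨?_, ?_⟩, fun n _ hn => ⟨?_, ?_⟩⟩
  · rintro ⟨𝓛, hD, h⟩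
    exact 𝓛.coefficients_eq_zero le_rfl hD (h 5 (by norm_num))
  · rintro ⟨rfl, rfl, rfl, rfl⟩
    exact ⟨.dephasing, TwoSiteLiouvillian.dissipator_dephasing_ne_zero,
      fun n _ hn => TwoSiteLiouvillian.globallyConserves_dephasing hn hx⟩
  · rintro ⟨𝓛, hD, h⟩
    exact 𝓛.coefficients_eq_zero hn hD h
  · rintro ⟨rfl, rfl, rfl, rfl⟩
    exact ⟨.dephasing, TwoSiteLiouvillian.dissipator_dephasing_ne_zero,
      TwoSiteLiouvillian.globallyConserves_dephasing (by omega) hx⟩
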